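/- A (deterministic, two-way) $k$-counter machine has a finite control, a two-way read-only head on an input tape $w$ bordered by two end-markers, and $k$ counters holding natural numbers. It starts on the first square to the right of the left end-marker with all counters zero. In one step, depending on the state, the scanned symbol and on which counters are zero, it changes its state, moves the head by at most one square, and changes each counter by at most one. It accepts by entering a final state, in which it halts; it also halts if no transition is defined. For $m\ge 1$ let $$L_m=\{\,x\,0^{2^{|x|/m}-|x|}\,\$\,0^{2^{|x|/m}-|x|}\,x^T \mid x\in\{0,1\}^*\,\},$$ where $x^T$ is the reversal of $x$ and $x$ ranges over the words for which $2^{|x|/m}-|x|$ is a natural number (that is, $m$ divides $|x|$ and $|x|\le 2^{|x|/m}$). Theorem. For every $m\ge 1$ the language $L_m$ can be accepted in $(2m+3)n+o(n)$ steps by a 4-counter machine: there are a 4-counter machine $M$ over the input alphabet $\{0,1,\$\}$ and a function $f(n)=o(n)$ such that $M$ accepts exactly the words of $L_m$ and, on every input of length $n$, halts after at most $(2m+3)n+f(n)$ steps. -/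

import Mathlib

open Filter Asymptotics

/-- The contents of a tape square: a letter of the input or one of the two end-markers. -/
inductive TapeSymbol (α : Type) : Type
  | leftEnd : TapeSymbol α
  | letter (a : α) : TapeSymbol α
  | rightEnd : TapeSymbol α

/-- Moves of the two-way input head in one step. -/
inductive HeadMove : Type
  | left
  | stay
  | right

/-- Operations on one counter in one step. -/
inductive CounterOp : Type
  | decrement
  | keep
  | increment

/-- A deterministic two-way machine with `k` (unbounded) counters over the input alphabet `α`.
In one step, depending on the state, on the tape symbol under the head, and on the outcome of the
zero-test of every counter (`true` means that the counter is zero), the machine enters a new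
state, moves the head by at most one square, and changes every counter by at most one.
Where `transition` is `none` the machine halts; it also halts, accepting, in a final state. -/
structure CounterMachine (k : ℕ) (α : Type) where
  State : Type
  finite_state : Finite State
  start : State
  final : State → Bool
  transition : State → TapeSymbol α → (Fin k → Bool) →
    Option (State × HeadMove × (Fin k → CounterOp))

/-- The symbol at tape position `p` on input `w`: position `0` holds the left end-marker,
positions `1, …, |w|` hold the input, position `|w| + 1` holds the right end-marker. -/
def tapeAt {α : Type} (w : List α) : ℕ → TapeSymbol α
  | 0 => TapeSymbol.leftEnd
  | p + 1 => (w[p]?).elim TapeSymbol.rightEnd TapeSymbol.letter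

/-- The new head position on an input of length `n`. A head never leaves the squares
`0, …, n + 1`: a move beyond an end-marker leaves it where it is. -/
def HeadMove.apply (n : ℕ) : HeadMove → ℕ → ℕ
  | HeadMove.left, p => p - 1
  | HeadMove.stay, p => p
  | HeadMove.right, p => min (p + 1) (n + 1)

/-- The new counter value. A counter holds a natural number; a decrement of zero
leaves it at zero. -/
def CounterOp.apply : CounterOp → ℕ → ℕ
  | CounterOp.decrement, v => v - 1
  | CounterOp.keep, v => v
  | CounterOp.increment, v => v + 1

namespace CounterMachine

variable {k : ℕ} {α : Type}

/-- A configuration: the state, the head position, and the counter values. -/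
structure Config (M : CounterMachine k α) where
  state : M.State
  head : ℕ
  counter : Fin k → ℕ

/-- The initial configuration: the head is next to the left end-marker, all counters are zero. -/
def init (M : CounterMachine k α) : M.Config where
  state := M.start
  head := 1
  counter := fun _ => 0

/-- One step on input `w`; `none` if the machine has halted. -/
def step (M : CounterMachine k α) (w : List α) (c : M.Config) : Option M.Config :=
  if M.final c.state then none
  else
    (M.transition c.state (tapeAt w c.head) (fun i => c.counter i == 0)).map fun r =>
      { state := r.1
        head := r.2.1.apply w.length c.head
        counter := fun i => (r.2.2 i).apply (c.counter i) }

/-- The configuration after `t` steps on input `w`, or the halting configuration if the machine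
halts earlier. -/
def run (M : CounterMachine k α) (w : List α) : ℕ → M.Config
  | 0 => M.init
  | t + 1 => (M.step w (M.run w t)).getD (M.run w t)

/-- The machine halts on input `w` after at most `t` steps. -/
def HaltsWithin (M : CounterMachine k α) (w : List α) (t : ℕ) : Prop :=
  M.step w (M.run w t) = none

/-- The machine accepts `w` if it enters a final state. -/
def Accepts (M : CounterMachine k α) (w : List α) : Prop :=
  ∃ t, M.final (M.run w t).state = true

/-- The language accepted by a counter machine. -/
def acceptedLanguage (M : CounterMachine k α) : Language α :=
  {w | M.Accepts w}

end CounterMachine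

/-- The input alphabet `{0, 1, $}`. -/
inductive Letter : Type
  | zero
  | one
  | dollar

/-- A binary digit as a letter. -/
def Letter.ofBit : Bool → Letter
  | false => Letter.zero
  | true => Letter.one

/-- The language of all words `x 0^(2^(|x|/m) - |x|) $ 0^(2^(|x|/m) - |x|) xᵀ` with
`x ∈ {0,1}*`, where `x` ranges over the words for which the exponent is a natural number,
i.e. `m ∣ |x|` and `|x| ≤ 2^(|x|/m)`. -/
def markedPalindromes (m : ℕ) : Language Letter :=
  {w | ∃ x : List Bool, m ∣ x.length ∧ x.length ≤ 2 ^ (x.length / m) ∧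
    w = x.map Letter.ofBit
        ++ List.replicate (2 ^ (x.length / m) - x.length) Letter.zero
        ++ [Letter.dollar]
        ++ List.replicate (2 ^ (x.length / m) - x.length) Letter.zero
        ++ (x.map Letter.ofBit).reverse}

/-! Coding all of `x` in one counter would need values near 2^|x|, far too large for unary
arithmetic. If each side of the dollar has N = 2^q digits, then |x| = m * q, and only about q / 2 of
these positions lie in a given residue class modulo 2 * m. The digits of one class therefore form a
binary number below 2 * √N (`classValue_lt`), used as a stack: pushing or popping a bit costs O(√N)
steps.

One pass stacks the digits of a class at one end, crosses the input and pops them against the digits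
at the other end, in n + O(√n log n) steps (`decides_pass`). The next pass starts where this one
ended and runs in the opposite direction, so 2 * m passes treat all classes without any return trips
(`decides_passes`). The passes also check the zero padding, each on the side where it starts.

Beforehand, one scan compares the lengths of the two sides, and repeated halving tests N = 2^q while
adding up m * q (`decides_halve`). This takes n steps and at most about 3 * N ≤ 2 * n steps, whence
the factor 2 * m + 3. Finally, `append_mem_markedPalindromes` translates the tests into membership.

The run is assembled backwards: each lemma on a phase takes the rest of the run as a hypothesis and
adds its own cost to the time budget. -/

namespace CounterMachine

/-! ### Halting within a time budget. -/

variable {k : ℕ} {α : Type}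

/-- Started in the configuration, `M` halts within the given number of steps, and it then is in a
final state exactly if `P` holds. -/
inductive Decides (M : CounterMachine k α) (w : List α) (P : Prop) : ℕ → M.Config → Prop
  | halt {T : ℕ} {c : M.Config} (h : M.step w c = none) (hP : M.final c.state = true ↔ P) :
      Decides M w P T c
  | step {T : ℕ} {c c' : M.Config} (h : M.step w c = some c') (hc : Decides M w P T c') :
      Decides M w P (T + 1) c

variable {M : CounterMachine k α} {w : List α} {P : Prop}

theorem Decides.mono {T T' : ℕ} {c : M.Config} (h : M.Decides w P T c) (hT : T ≤ T') :
    M.Decides w P T' c := by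
  induction h generalizing T' with
  | halt h hP => exact .halt h hP
  | step h _ ih =>
    obtain ⟨s, rfl⟩ : ∃ s, T' = s + 1 := ⟨T' - 1, by omega⟩
    exact .step h (ih (by omega))

theorem Decides.exists_halt {T : ℕ} {c : M.Config} (h : M.Decides w P T c) {s : ℕ}
    (hs : M.run w s = c) :
    ∃ t ≤ s + T, M.step w (M.run w t) = none ∧ (M.final (M.run w t).state = true ↔ P) := by
  induction h generalizing s with
  | halt h hP => exact ⟨s, by omega, hs ▸ h, hs ▸ hP⟩
  | @step T c c' h _ ih =>
    obtain ⟨t, ht, h1, h2⟩ := ih (s := s + 1) (by simp [run, hs, h])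
    exact ⟨t, by omega, h1, h2⟩

theorem run_add_of_halted {t : ℕ} (h : M.step w (M.run w t) = none) (s : ℕ) :
    M.run w (t + s) = M.run w t := by
  induction s with
  | zero => rfl
  | succ s ih => rw [← add_assoc, run, ih, h]; rfl

/-- A final state halts, and a run never leaves its first halting configuration, so acceptance can
only occur in the one halting configuration that `Decides` describes. -/
theorem Decides.accepts_iff {T : ℕ} (h : M.Decides w P T M.init) : M.Accepts w ↔ P := by
  obtain ⟨t, -, h1, h2⟩ := h.exists_halt (s := 0) rfl
  constructor
  · rintro ⟨s, hs⟩
    have h3 : M.step w (M.run w s) = none := by simp [CounterMachine.step, hs]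
    have h4 : M.run w t = M.run w s := by
      rw [← run_add_of_halted h1 s, add_comm, run_add_of_halted h3]
    exact h2.1 (h4 ▸ hs)
  · exact fun hP => ⟨t, h2.2 hP⟩

theorem Decides.exists_haltsWithin {T : ℕ} (h : M.Decides w P T M.init) :
    ∃ t ≤ T, M.HaltsWithin w t := by
  obtain ⟨t, ht, h1, -⟩ := h.exists_halt (s := 0) rfl
  exact ⟨t, by omega, h1⟩

end CounterMachine

/-! ### The machine. -/

/-- The kinds of states of the machine for `markedPalindromes m`. -/
inductive Phase : Type
  | scanLeft | scanRight
  | halve | halveOdd | addLength | copy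
  | encode | double | doubleOdd | doubleBack
  | zeros | cross | skip
  | decode | half | halfOdd | halfBack
  | restore | accept
  deriving DecidableEq

/-- The states of the machine: `side` tells at which end of the input the machine works (`true`
is the right end), `cls` is the residue class modulo `2 * m` of squares that is being compared,
`idx` is a counter modulo `2 * m`. -/
structure Control (m : ℕ) : Type where
  phase : Phase
  side : Bool
  cls : ZMod (2 * m)
  idx : ZMod (2 * m)

theorem Phase.finite : Finite Phase := by
  have h (p : Phase) : p.ctorIdx < 19 := by cases p <;> decide
  refine Finite.of_injective (fun p : Phase => (⟨p.ctorIdx, h p⟩ : Fin 19)) fun p q hpq => ?_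
  cases p <;> cases q <;> first | rfl | cases hpq

theorem Control.finite (m : ℕ) [NeZero m] : Finite (Control m) := by
  have : NeZero (2 * m) := ⟨by have := NeZero.ne m; omega⟩
  have := Phase.finite
  refine Finite.of_injective
    (fun s : Control m => (s.phase, s.side, s.cls, s.idx)) fun s t h => ?_
  cases s; cases t; simp_all

/-- The binary digit on a tape square, if there is one. -/
def TapeSymbol.bit : TapeSymbol Letter → Option Bool
  | .letter .zero => some false
  | .letter .one => some true
  | _ => none

@[simp] theorem TapeSymbol.bit_ofBit (x : Bool) :
    TapeSymbol.bit (.letter (Letter.ofBit x)) = some x := by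
  cases x <;> rfl

/-- The move that leads away from the end of the input on side `d`. -/
def HeadMove.away (d : Bool) : HeadMove := if d then .left else .right

/-- The square at distance `o` from the end-marker on side `d`, for inputs of length `n`. -/
def squareAt (n : ℕ) (d : Bool) (o : ℕ) : ℕ := if d then n + 1 - o else o

theorem away_apply_squareAt {n o : ℕ} (d : Bool) (h : o ≤ n) :
    (HeadMove.away d).apply n (squareAt n d o) = squareAt n d (o + 1) := by
  cases d <;> simp [HeadMove.away, squareAt, HeadMove.apply] <;> omega

theorem away_not_apply_squareAt {n o : ℕ} (d : Bool) (h : o ≤ n) :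
    (HeadMove.away !d).apply n (squareAt n d (o + 1)) = squareAt n d o := by
  cases d <;> simp [HeadMove.away, squareAt, HeadMove.apply]; omega

theorem squareAt_not {n o : ℕ} (d : Bool) (h : o ≤ n + 1) :
    squareAt n (!d) o = squareAt n d (n + 1 - o) := by
  cases d <;> simp [squareAt]; omega

open HeadMove CounterOp in
/-- The transitions of the machine for `markedPalindromes m`, in terms of the zero-tests of its
four counters `A`, `B`, `L`, `K`; the new state and the move are followed by the operations on
these counters.

First `A` and `B` serve to find `l` with `2 ^ l` squares on each side of the dollar, and `L`
becomes `m * l`. Then, for each residue class modulo `2 * m`, the digits in that class among the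
first `m * l` squares from one end are encoded in `A`; the machine crosses the input and compares
them with the digits at the other end. `L` and `K` measure distances of at most `m * l`. -/
def controlStep (m : ℕ) (s : Control m) (x : TapeSymbol Letter) (zA zB zL zK : Bool) :
    Option (Control m × HeadMove × CounterOp × CounterOp × CounterOp × CounterOp) :=
  let ⟨p, d, r, i⟩ := s
  match p with
  | .scanLeft => match x with
    | .letter .dollar => some (⟨.scanRight, d, r, i⟩, right, keep, keep, keep, keep)
    | .letter _ => some (⟨.scanLeft, d, r, i⟩, right, increment, keep, keep, keep)
    | _ => none
  | .scanRight => match x with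
    | .letter .dollar => none
    | .letter _ => if zA then none else
        some (⟨.scanRight, d, r, i⟩, right, decrement, increment, keep, keep)
    | .rightEnd => if zA then some (⟨.halve, d, r, i⟩, stay, keep, keep, keep, keep) else none
    | .leftEnd => none
  | .halve =>
      if zB then
        if zA then none else some (⟨.addLength, d, r, 0⟩, stay, keep, keep, keep, keep)
      else some (⟨.halveOdd, d, r, i⟩, stay, keep, decrement, keep, keep)
  | .halveOdd =>
      if zB then
        if zA then some (⟨.encode, true, 0, 0⟩, away true, keep, keep, keep, keep) else none
      else some (⟨.halve, d, r, i⟩, stay, increment, decrement, keep, keep)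
  | .addLength =>
      if i = (m : ZMod (2 * m)) then some (⟨.copy, d, r, i⟩, stay, keep, keep, keep, keep)
      else some (⟨.addLength, d, r, i + 1⟩, stay, keep, keep, increment, keep)
  | .copy =>
      if zA then some (⟨.halve, d, r, i⟩, stay, keep, keep, keep, keep)
      else some (⟨.copy, d, r, i⟩, stay, decrement, increment, keep, keep)
  | .encode =>
      if zL then some (⟨.zeros, d, r, i⟩, stay, keep, keep, keep, keep)
      else match x.bit with
      -- No digit is left on this side although `L` is not yet zero, so m * l exceeds the number of
      -- digits.
      | none => none
      | some _ =>
        if i = r then some (⟨.double, d, r, i⟩, stay, keep, keep, keep, keep)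
        else some (⟨.encode, d, r, i + 1⟩, away d, keep, keep, decrement, increment)
  | .double =>
      if zA then some (⟨.doubleBack, d, r, i⟩, stay, keep, keep, keep, keep)
      else some (⟨.doubleOdd, d, r, i⟩, stay, decrement, increment, keep, keep)
  | .doubleOdd => some (⟨.double, d, r, i⟩, stay, keep, increment, keep, keep)
  | .doubleBack =>
      if zB then some (⟨.encode, d, r, i + 1⟩, away d,
        if x.bit = some true then increment else keep, keep, decrement, increment)
      else some (⟨.doubleBack, d, r, i⟩, stay, increment, decrement, keep, keep)
  | .zeros => match x with
    | .letter .zero => some (⟨.zeros, d, r, i⟩, away d, keep, keep, keep, keep)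
    | .letter .dollar => some (⟨.cross, d, r, i⟩, away d, keep, keep, keep, keep)
    | _ => none
  | .cross => match x with
    | .letter _ => some (⟨.cross, d, r, i⟩, away d, keep, keep, keep, keep)
    | _ => some (⟨.skip, !d, r, 0⟩, away !d, keep, keep, keep, keep)
  | .skip =>
      if zK then some (⟨.decode, d, r, i⟩, away !d, keep, keep, keep, keep)
      else some (⟨.skip, d, r, i + 1⟩, away d, keep, keep, increment, decrement)
  | .decode =>
      if zL then some (⟨.restore, d, r, i⟩, stay, keep, keep, keep, keep)
      -- At distance o from the end-marker `i` is o modulo 2 * m, while the digit there has index o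
      -- - 1.
      else if i - 1 = r then some (⟨.half, d, r, i⟩, stay, keep, keep, keep, keep)
      else some (⟨.decode, d, r, i - 1⟩, away !d, keep, keep, decrement, increment)
  | .half =>
      if zA then
        if x.bit = some false then some (⟨.halfBack, d, r, i⟩, stay, keep, keep, keep, keep)
        else none
      else some (⟨.halfOdd, d, r, i⟩, stay, decrement, keep, keep, keep)
  | .halfOdd =>
      if zA then
        if x.bit = some true then some (⟨.halfBack, d, r, i⟩, stay, keep, keep, keep, keep)
        else none
      else some (⟨.half, d, r, i⟩, stay, decrement, increment, keep, keep)
  | .halfBack =>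
      if zB then some (⟨.decode, d, r, i - 1⟩, away !d, keep, keep, decrement, increment)
      else some (⟨.halfBack, d, r, i⟩, stay, increment, decrement, keep, keep)
  | .restore =>
      if zK then
        if r = -1 then some (⟨.accept, d, r, i⟩, stay, keep, keep, keep, keep)
        else some (⟨.encode, d, r + 1, 0⟩, away d, keep, keep, keep, keep)
      else some (⟨.restore, d, r, i⟩, stay, keep, keep, increment, decrement)
  | .accept => none

/-- The machine for `markedPalindromes m`. -/
def palindromeMachine (m : ℕ) [NeZero m] : CounterMachine 4 Letter where
  State := Control m
  finite_state := Control.finite m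
  start := ⟨.scanLeft, true, 0, 0⟩
  final s := s.phase == .accept
  transition s x z := (controlStep m s x (z 0) (z 1) (z 2) (z 3)).map
    fun q => (q.1, q.2.1, ![q.2.2.1, q.2.2.2.1, q.2.2.2.2.1, q.2.2.2.2.2])

/-- The configuration with the given state, head position and counters. -/
def config {m : ℕ} [NeZero m] (p : Phase) (d : Bool) (r i : ZMod (2 * m)) (h a b l k : ℕ) :
    (palindromeMachine m).Config :=
  ⟨(⟨p, d, r, i⟩ : Control m), h, ![a, b, l, k]⟩

section

variable {m : ℕ} [NeZero m] {p : Phase} {d : Bool} {r i : ZMod (2 * m)} {h a b l k : ℕ}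
  {w : List Letter} {P : Prop}

theorem step_config :
    (palindromeMachine m).step w (config p d r i h a b l k) =
      (controlStep m ⟨p, d, r, i⟩ (tapeAt w h) (a == 0) (b == 0) (l == 0) (k == 0)).map fun q =>
        config q.1.phase q.1.side q.1.cls q.1.idx (q.2.1.apply w.length h) (q.2.2.1.apply a)
          (q.2.2.2.1.apply b) (q.2.2.2.2.1.apply l) (q.2.2.2.2.2.apply k) := by
  by_cases hp : p = .accept
  · subst hp; simp [CounterMachine.step, palindromeMachine, config, controlStep]
  · simp only [CounterMachine.step, palindromeMachine, config, beq_iff_eq, hp, if_false,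
      Option.map_map]
    congr 1
    funext q
    simp only [Function.comp, CounterMachine.Config.mk.injEq, true_and]
    funext j
    fin_cases j <;> rfl

theorem decides_reject {x : TapeSymbol Letter} (hP : ¬ P) (hx : tapeAt w h = x) (hp : p ≠ .accept)
    (hc : controlStep m ⟨p, d, r, i⟩ x (a == 0) (b == 0) (l == 0) (k == 0) = none) {T : ℕ} :
    (palindromeMachine m).Decides w P T (config p d r i h a b l k) :=
  .halt (by rw [step_config, hx, hc]; rfl) (by simp [palindromeMachine, config, hP, hp])

theorem decides_accept (hP : P) {T : ℕ} :
    (palindromeMachine m).Decides w P T (config .accept d r i h a b l k) :=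
  .halt (by rw [step_config]; rfl) (by simp [palindromeMachine, config, hP])

theorem decides_step {p' : Phase} {d' : Bool} {r' i' : ZMod (2 * m)} {h' a' b' l' k' T : ℕ}
    {x : TapeSymbol Letter} {mv : HeadMove} {oa ob ol ok : CounterOp}
    (hd : (palindromeMachine m).Decides w P T (config p' d' r' i' h' a' b' l' k'))
    (hx : tapeAt w h = x)
    (hc : controlStep m ⟨p, d, r, i⟩ x (a == 0) (b == 0) (l == 0) (k == 0) =
      some (⟨p', d', r', i'⟩, mv, oa, ob, ol, ok))
    (hh : mv.apply w.length h = h' := by rfl) (ha : oa.apply a = a' := by rfl)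
    (hb : ob.apply b = b' := by rfl) (hl : ol.apply l = l' := by rfl)
    (hk : ok.apply k = k' := by rfl) :
    (palindromeMachine m).Decides w P (T + 1) (config p d r i h a b l k) :=
  .step (by rw [step_config, hx, hc]; subst hh ha hb hl hk; rfl) hd

end

/-! ### Scanning the input and testing the length for a power of two. -/

section

variable {m : ℕ} [NeZero m] {d : Bool} {r i : ZMod (2 * m)} {h a b l k : ℕ}
  {w : List Letter} {P : Prop}

theorem tapeAt_append_succ {α : Type} (s t : List α) :
    tapeAt (s ++ t) (s.length + 1) = (t[0]?).elim .rightEnd .letter := by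
  simp [tapeAt, List.getElem?_append_right]

/-- The form shared by all phases that test something: `hT` provides the rest of the run only in
case the test succeeds, and `hP` makes the test necessary for `P`, so that rejecting is right when
it fails. -/
theorem decides_scanRight {T : ℕ} (s t : List Letter) (hw : w = s ++ t)
    (hT : ∀ v : List Bool, t = v.map Letter.ofBit → v.length = a → (palindromeMachine m).Decides w P T
      (config .halve d r i (w.length + 1) 0 (b + a) 0 0))
    (hP : P → ∃ v : List Bool, t = v.map Letter.ofBit ∧ v.length = a) :
    (palindromeMachine m).Decides w P (T + (t.length + 1))
      (config .scanRight d r i (s.length + 1) a b 0 0) := by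
  induction t generalizing s a b with
  | nil =>
    have hx : tapeAt w (s.length + 1) = .rightEnd := by rw [hw, tapeAt_append_succ]; rfl
    cases a with
    | zero => exact decides_step (hT [] rfl rfl) hx rfl (by simp [HeadMove.apply, hw])
    | succ a =>
      refine decides_reject (fun h => ?_) hx (by simp) rfl
      obtain ⟨v, hv, hl⟩ := hP h
      have := congrArg List.length hv
      simp [hl] at this
  | cons y t ih =>
    have hx : tapeAt w (s.length + 1) = .letter y := by rw [hw, tapeAt_append_succ]; rfl
    have key (β : Bool) (hy : y = Letter.ofBit β) : (palindromeMachine m).Decides w P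
        (T + ((y :: t).length + 1)) (config .scanRight d r i (s.length + 1) a b 0 0) := by
      subst hy
      cases a with
      | zero =>
        refine decides_reject (fun h => ?_) hx (by simp) (by cases β <;> rfl)
        obtain ⟨v, hv, hl⟩ := hP h
        simp_all
      | succ a =>
        refine decides_step (T := T + (t.length + 1)) (oa := .decrement) (ob := .increment)
          (mv := .right) (ih (a := a) (b := b + 1) (s ++ [Letter.ofBit β]) (by simp [hw]) ?_ ?_) hx
          (by cases β <;> rfl) (by simp [HeadMove.apply, hw]) rfl rfl rfl rfl
        · intro v hv hl
          have := hT (β :: v) (by simp [hv]) (by simp [hl])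
          rwa [show b + 1 + a = b + (a + 1) by omega]
        · intro h
          obtain ⟨v, hv, hl⟩ := hP h
          cases v with
          | nil => simp at hv
          | cons c v => exact ⟨v, by simpa using (List.cons.inj hv).2, by simpa using hl⟩
    cases y with
    | zero => exact key false rfl
    | one => exact key true rfl
    | dollar =>
      refine decides_reject (fun h => ?_) hx (by simp) rfl
      obtain ⟨v, hv, hl⟩ := hP h
      cases v with
      | nil => simp at hv
      | cons c v => cases c <;> simp [Letter.ofBit] at hv

theorem decides_scanLeft {T : ℕ} (s t : List Letter) (hw : w = s ++ t)
    (hT : ∀ u v : List Bool, t = u.map Letter.ofBit ++ .dollar :: v.map Letter.ofBit →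
      v.length = a + u.length → (palindromeMachine m).Decides w P T
      (config .halve d r i (w.length + 1) 0 v.length 0 0))
    (hP : P → ∃ u v : List Bool, t = u.map Letter.ofBit ++ .dollar :: v.map Letter.ofBit ∧
      v.length = a + u.length) :
    (palindromeMachine m).Decides w P (T + (t.length + 1))
      (config .scanLeft d r i (s.length + 1) a 0 0 0) := by
  induction t generalizing s a with
  | nil =>
    have hx : tapeAt w (s.length + 1) = .rightEnd := by rw [hw, tapeAt_append_succ]; rfl
    refine decides_reject (fun h => ?_) hx (by simp) rfl
    obtain ⟨u, v, hv, -⟩ := hP h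
    simp at hv
  | cons y t ih =>
    have hx : tapeAt w (s.length + 1) = .letter y := by rw [hw, tapeAt_append_succ]; rfl
    have key (β : Bool) (hy : y = Letter.ofBit β) : (palindromeMachine m).Decides w P
        (T + ((y :: t).length + 1)) (config .scanLeft d r i (s.length + 1) a 0 0 0) := by
      subst hy
      refine decides_step (T := T + (t.length + 1)) (oa := .increment)
        (mv := .right) (ih (a := a + 1) (s ++ [Letter.ofBit β]) (by simp [hw]) ?_ ?_) hx
        (by cases β <;> rfl) (by simp [HeadMove.apply, hw]) rfl rfl rfl rfl
      · intro u v hv hl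
        exact hT (β :: u) v (by simp [hv]) (by simp [hl]; omega)
      · intro h
        obtain ⟨u, v, hv, hl⟩ := hP h
        cases u with
        | nil => cases β <;> simp [Letter.ofBit] at hv
        | cons c u =>
          exact ⟨u, v, by simpa using (List.cons.inj hv).2, by simp at hl; omega⟩
    cases y with
    | zero => exact key false rfl
    | one => exact key true rfl
    | dollar =>
      refine decides_step (T := T + (t.length + 1)) (mv := .right)
        (decides_scanRight (a := a) (b := 0) (s ++ [.dollar]) t (by simp [hw]) ?_ ?_) hx
          rfl (by simp [HeadMove.apply, hw])
      · intro v hv hl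
        simpa [hl] using hT [] v (by simp [hv]) (by simp [hl])
      · intro h
        obtain ⟨u, v, hv, hl⟩ := hP h
        cases u with
        | nil => exact ⟨v, by simpa using hv, by simpa using hl⟩
        | cons c u => cases c <;> simp [Letter.ofBit] at hv

theorem decides_copy {T : ℕ}
    (hT : (palindromeMachine m).Decides w P T (config .halve d r i h 0 (b + a) l k)) :
    (palindromeMachine m).Decides w P (T + (a + 1)) (config .copy d r i h a b l k) := by
  induction a generalizing b with
  | zero => exact decides_step hT rfl rfl
  | succ a ih =>
    refine decides_step (T := T + (a + 1)) (ih (b := b + 1) ?_) rfl rfl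
    rwa [show b + 1 + a = b + (a + 1) by omega]

theorem decides_addLength {T : ℕ} (j : ℕ) {c : ℕ} (hj : c + j = m)
    (hT : (palindromeMachine m).Decides w P T (config .copy d r m h a b (l + j) k)) :
    (palindromeMachine m).Decides w P (T + (j + 1)) (config .addLength d r c h a b l k) := by
  induction j generalizing c l with
  | zero =>
    obtain rfl : c = m := by omega
    exact decides_step hT rfl (if_pos rfl)
  | succ j ih =>
    -- Both c < m and m are below the modulus 2 * m, so no wrap-around stops the count early.
    have hne : (c : ZMod (2 * m)) ≠ (m : ZMod (2 * m)) := by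
      rw [Ne, ZMod.natCast_eq_natCast_iff', Nat.mod_eq_of_lt, Nat.mod_eq_of_lt] <;> omega
    refine decides_step (T := T + (j + 1)) (ih (c := c + 1) (l := l + 1) (by omega) ?_) rfl
      ((if_neg hne).trans (by push_cast; rfl))
    rwa [show l + 1 + j = l + (j + 1) by omega]

/-- Halving `B` moves half of it to `A`. -/
theorem decides_halve_of_even {T : ℕ}
    (hT : (palindromeMachine m).Decides w P T (config .halve d r i h (a + b) 0 l k)) :
    (palindromeMachine m).Decides w P (T + 2 * b) (config .halve d r i h a (2 * b) l k) := by
  induction b generalizing a with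
  | zero => exact hT
  | succ b ih =>
    rw [show a + (b + 1) = a + 1 + b by omega] at hT
    have h1 : (palindromeMachine m).Decides w P (T + 2 * b + 1)
        (config .halveOdd d r i h a (2 * b + 1) l k) := decides_step (ih hT) rfl rfl
    exact decides_step h1 rfl rfl

theorem decides_halve_of_odd {T : ℕ}
    (hT : (palindromeMachine m).Decides w P T (config .halveOdd d r i h (a + b) 0 l k)) :
    (palindromeMachine m).Decides w P (T + 2 * b + 1)
      (config .halve d r i h a (2 * b + 1) l k) := by
  induction b generalizing a with
  | zero => exact decides_step hT rfl rfl
  | succ b ih =>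
    rw [show a + (b + 1) = a + 1 + b by omega] at hT
    have h1 : (palindromeMachine m).Decides w P (T + 2 * b + 1 + 1)
        (config .halveOdd d r i h a (2 * b + 2) l k) := decides_step (ih hT) rfl rfl
    exact decides_step h1 rfl rfl

/-- Passing from 2 * c to c costs 2 * c steps for halving and c for copying back, which sums
geometrically to 3 * b. The overhead of a round is m + 3: m + 1 for adding m to `L`, and one step
each for leaving `halve` and `copy`. -/
theorem decides_halve {T : ℕ}
    (hT : ∀ q, b = 2 ^ q → (palindromeMachine m).Decides w P T
      (config .encode true 0 0 ((HeadMove.away true).apply w.length h) 0 0 (l + m * q) k))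
    (hP : P → ∃ q, b = 2 ^ q) :
    (palindromeMachine m).Decides w P (T + 3 * b + (m + 3) * (Nat.log 2 b + 1))
      (config .halve d r i h 0 b l k) := by
  induction b using Nat.strong_induction_on generalizing l i with
  | _ b ih =>
  obtain ⟨c, rfl | rfl⟩ := Nat.even_or_odd' b
  · obtain rfl | hc := Nat.eq_zero_or_pos c
    · refine decides_reject (fun h => ?_) rfl (by simp) rfl
      obtain ⟨q, hq⟩ := hP h
      have := Nat.two_pow_pos q
      omega
    have h1 : (palindromeMachine m).Decides w P (T + 3 * c + (m + 3) * (Nat.log 2 c + 1))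
        (config .halve d r m h 0 c (l + m) k) := by
      refine ih c (by omega) (fun q hq => ?_) fun h => ?_
      · have := hT (q + 1) (by rw [hq, pow_succ, mul_comm])
        rwa [show l + m + m * q = l + m * (q + 1) by ring]
      · obtain ⟨q, hq⟩ := hP h
        cases q with
        | zero => omega
        | succ q => exact ⟨q, by rw [pow_succ] at hq; omega⟩
    have h2 : (palindromeMachine m).Decides w P _ (config .addLength d r (0 : ℕ) h c 0 l k) :=
      decides_addLength (c := 0) m (by omega) (decides_copy (by simpa using h1))
    obtain ⟨c, rfl⟩ : ∃ c', c = c' + 1 := ⟨c - 1, by omega⟩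
    have h3 := decides_halve_of_even (a := 0) (b := c + 1) (i := i)
      (by rw [zero_add]; exact decides_step (by simpa using h2) rfl rfl)
    refine h3.mono ?_
    have : Nat.log 2 (2 * (c + 1)) = Nat.log 2 (c + 1) + 1 := by
      rw [mul_comm, Nat.log_mul_base (by omega) (by omega)]
    rw [this]
    nlinarith
  · obtain rfl | hc := Nat.eq_zero_or_pos c
    · have h1 := hT 0 rfl
      rw [mul_zero, add_zero] at h1
      refine (decides_halve_of_odd (a := 0) (b := 0)
        (decides_step (a := 0) h1 rfl rfl)).mono ?_
      simp
      omega
    -- An odd number greater than 1 is not a power of two.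
    · have hn : ¬ P := fun h => by
        obtain ⟨q, hq⟩ := hP h
        cases q with
        | zero => simp at hq; omega
        | succ q => rw [pow_succ] at hq; omega
      obtain ⟨c, rfl⟩ : ∃ c', c = c' + 1 := ⟨c - 1, by omega⟩
      refine (decides_halve_of_odd (T := 0) (a := 0) (b := c + 1) ?_).mono (by nlinarith)
      rw [zero_add]
      exact decides_reject hn rfl (by simp) rfl

end

/-! ### Digits on the tape and the code of a residue class. -/

/-- The input consists of `N` binary digits, a dollar, and `N` binary digits; `f d o` is the digit
with `o` digits between it and the end of the input on side `d`. -/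
structure MarkedTape (w : List Letter) (N : ℕ) (f : Bool → ℕ → Bool) : Prop where
  length : w.length = 2 * N + 1
  marker (d : Bool) :
    tapeAt w (squareAt w.length d 0) = if d then .rightEnd else .leftEnd
  dollar (d : Bool) : tapeAt w (squareAt w.length d (N + 1)) = .letter .dollar
  digit (d : Bool) {o : ℕ} (ho : o < N) :
    tapeAt w (squareAt w.length d (o + 1)) = .letter (Letter.ofBit (f d o))

/-- The number with binary digits `f o`, where `o < n` runs through the residue class `r`. -/
def classValue {q : ℕ} (r : ZMod q) (f : ℕ → Bool) : ℕ → ℕ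
  | 0 => 0
  | o + 1 => if (o : ZMod q) = r then 2 * classValue r f o + (f o).toNat else classValue r f o

/-- Only positions in the class contribute a bit, and at most n / q + 1 of the first n positions do.
-/
theorem classValue_lt {q : ℕ} [NeZero q] (r : ZMod q) (f : ℕ → Bool) (n : ℕ) :
    classValue r f n < 2 ^ (n / q + 1) := by
  have h (o : ℕ) : classValue r f o < 2 ^ Nat.count (fun j => j ≡ r.val [MOD q]) o := by
    induction o with
    | zero => simp [classValue]
    | succ o ih =>
      have h1 : o ≡ r.val [MOD q] ↔ (o : ZMod q) = r := by
        rw [← ZMod.natCast_eq_natCast_iff, ZMod.natCast_zmod_val]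
      have h2 : (f o).toNat < 2 := Bool.toNat_lt _
      rw [Nat.count_succ, classValue]
      by_cases h3 : (o : ZMod q) = r
      · rw [if_pos h3, if_pos (h1.2 h3), pow_succ]
        omega
      · rwa [if_neg h3, if_neg (mt h1.1 h3), add_zero]
  refine (h n).trans_le (Nat.pow_le_pow_right (by omega) ?_)
  rw [Nat.count_modEq_card _ (NeZero.pos q)]
  split <;> omega

/-! ### The stages of one pass. -/

section

variable {m : ℕ} [NeZero m] {d : Bool} {r i : ZMod (2 * m)} {h a b l k : ℕ}
  {w : List Letter} {P : Prop}

theorem decides_double {T : ℕ}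
    (hT : (palindromeMachine m).Decides w P T (config .doubleBack d r i h 0 (b + 2 * a) l k)) :
    (palindromeMachine m).Decides w P (T + 2 * a + 1) (config .double d r i h a b l k) := by
  induction a generalizing b with
  | zero => exact decides_step hT rfl rfl
  | succ a ih =>
    rw [show b + 2 * (a + 1) = b + 2 + 2 * a by ring] at hT
    have h1 : (palindromeMachine m).Decides w P (T + 2 * a + 1 + 1)
        (config .doubleOdd d r i h a (b + 1) l k) := decides_step (ih hT) rfl rfl
    exact decides_step h1 rfl rfl

theorem decides_doubleBack {T : ℕ} {β : Bool} (hx : tapeAt w h = .letter (Letter.ofBit β))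
    (hT : (palindromeMachine m).Decides w P T (config .encode d r (i + 1)
      ((HeadMove.away d).apply w.length h) (a + b + β.toNat) 0 l (k + 1))) :
    (palindromeMachine m).Decides w P (T + b + 1) (config .doubleBack d r i h a b (l + 1) k) := by
  induction b generalizing a with
  | zero =>
    refine decides_step hT hx rfl rfl ?_
    cases β <;> rfl
  | succ b ih =>
    refine decides_step (ih (a := a + 1) ?_) rfl rfl
    rwa [show a + 1 + b = a + (b + 1) by omega]

/-- Popping a bit: whether `A` runs empty in `half` or in `halfOdd` reveals its parity, the bit
pushed last, while the remaining stack gathers in `B`. -/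
theorem decides_half {T : ℕ} {β γ : Bool} (hx : tapeAt w h = .letter (Letter.ofBit γ))
    (hT : β = γ → (palindromeMachine m).Decides w P T (config .halfBack d r i h 0 (b + a) l k))
    (hP : P → β = γ) :
    (palindromeMachine m).Decides w P (T + 2 * a + 2)
      (config .half d r i h (2 * a + β.toNat) b l k) := by
  induction a generalizing b with
  | zero =>
    by_cases hβ : β = γ
    · subst hβ
      cases β with
      | false => exact (decides_step (T := T) (a := 0) (hT rfl) hx rfl).mono (by omega)
      | true =>
        have h1 : (palindromeMachine m).Decides w P (T + 1) (config .halfOdd d r i h 0 b l k) :=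
          decides_step (hT rfl) hx rfl
        exact decides_step (a := 1) h1 rfl rfl
    · cases β with
      | false =>
        obtain rfl : γ = true := by simpa using hβ
        exact decides_reject (mt hP hβ) hx (by simp) rfl
      | true =>
        obtain rfl : γ = false := by simpa using hβ
        have h1 : (palindromeMachine m).Decides w P (T + 1) (config .halfOdd d r i h 0 b l k) :=
          decides_reject (mt hP hβ) hx (by simp) rfl
        exact decides_step (a := 1) h1 rfl rfl
  | succ a ih =>
    have h0 := ih (b := b + 1) (by rwa [show b + 1 + a = b + (a + 1) by omega])
    rw [show 2 * (a + 1) + β.toNat = 2 * a + β.toNat + 1 + 1 by ring]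
    have h1 : (palindromeMachine m).Decides w P (T + 2 * a + 2 + 1)
        (config .halfOdd d r i h (2 * a + β.toNat + 1) b l k) := decides_step h0 rfl rfl
    exact decides_step h1 rfl rfl

theorem decides_halfBack {T : ℕ}
    (hT : (palindromeMachine m).Decides w P T (config .decode d r (i - 1)
      ((HeadMove.away !d).apply w.length h) (a + b) 0 l (k + 1))) :
    (palindromeMachine m).Decides w P (T + b + 1) (config .halfBack d r i h a b (l + 1) k) := by
  induction b generalizing a with
  | zero => exact decides_step hT rfl rfl
  | succ b ih =>
    refine decides_step (ih (a := a + 1) ?_) rfl rfl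
    rwa [show a + 1 + b = a + (b + 1) by omega]

theorem decides_restore {T : ℕ}
    (hT : (palindromeMachine m).Decides w P T (config .restore d r i h a b (l + k) 0)) :
    (palindromeMachine m).Decides w P (T + k) (config .restore d r i h a b l k) := by
  induction k generalizing l with
  | zero => exact hT
  | succ k ih =>
    refine decides_step (T := T + k) (ih (l := l + 1) ?_) rfl rfl
    rwa [show l + 1 + k = l + (k + 1) by omega]

variable {N : ℕ} {f : Bool → ℕ → Bool}

/-- For a stack value v ≤ S, a push takes 2 * v + 1 steps to double, 2 * v + 1 to move back and one
to enter: at most 4 * S + 3. Positions outside the class take one step. -/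
theorem decides_encode (hw : MarkedTape w N f) {T S o j : ℕ} (ho : o ≤ N)
    (hS : ∀ o' ≤ o + j, classValue r (f d) o' ≤ S)
    (hT : o + j ≤ N → (palindromeMachine m).Decides w P T (config .zeros d r (o + j : ℕ)
      (squareAt w.length d (o + j + 1)) (classValue r (f d) (o + j)) 0 0 (o + j)))
    (hP : P → o + j ≤ N) :
    (palindromeMachine m).Decides w P (T + j * (4 * S + 3) + 1) (config .encode d r o
      (squareAt w.length d (o + 1)) (classValue r (f d) o) 0 j o) := by
  induction j generalizing o with
  | zero => exact (decides_step (hT ho) rfl rfl).mono (by omega)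
  | succ j ih =>
    obtain rfl | hlt := ho.eq_or_lt
    -- The head has reached the dollar with squares still to read, so the prefix does not fit.
    · exact decides_reject (fun h => by have := hP h; omega) (hw.dollar d) (by simp) rfl
    have hx := hw.digit d hlt
    have hlen := hw.length
    have hmv : (HeadMove.away d).apply w.length (squareAt w.length d (o + 1)) =
        squareAt w.length d (o + 1 + 1) := away_apply_squareAt d (by omega)
    rw [show o + (j + 1) = o + 1 + j by omega] at hT hP hS
    have h0 := ih (o := o + 1) hlt hS hT hP
    have hS0 : classValue r (f d) o ≤ S := hS o (by omega)
    by_cases hr : (o : ZMod (2 * m)) = r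
    · have h1 : (palindromeMachine m).Decides w P
          (T + j * (4 * S + 3) + 1 + (0 + 2 * classValue r (f d) o) + 1) (config .doubleBack d r o
          (squareAt w.length d (o + 1)) 0 (0 + 2 * classValue r (f d) o) (j + 1) o) := by
        refine decides_doubleBack hx ?_ (T := T + j * (4 * S + 3) + 1)
        rw [hmv]
        rw [classValue, if_pos hr] at h0
        push_cast at h0
        convert h0 using 2
        ring
      have hc : controlStep m ⟨.encode, d, r, o⟩ (.letter (Letter.ofBit (f d o)))
          (classValue r (f d) o == 0) (0 == 0) (j + 1 == 0) (o == 0) = some (⟨.double, d, r, o⟩,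
          .stay, .keep, .keep, .keep, .keep) := by
        cases f d o <;> exact if_pos hr
      refine (decides_step (decides_double h1) hx hc).mono ?_
      have : (j + 1) * (4 * S + 3) = j * (4 * S + 3) + (4 * S + 3) := by ring
      omega
    · rw [classValue, if_neg hr] at h0
      have hc : controlStep m ⟨.encode, d, r, o⟩ (.letter (Letter.ofBit (f d o)))
          (classValue r (f d) o == 0) (0 == 0) (j + 1 == 0) (o == 0) = some (⟨.encode, d, r,
          (o + 1 : ℕ)⟩, .away d, .keep, .keep, .decrement, .increment) := by
        push_cast
        cases f d o <;> exact if_neg hr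
      exact (decides_step h0 hx hc hmv).mono (by nlinarith)

theorem decides_zeros (hw : MarkedTape w N f) {T o j : ℕ} (ho : o + j = N)
    (hT : (∀ o', o ≤ o' → o' < N → f d o' = false) → (palindromeMachine m).Decides w P T
      (config .cross d r i (squareAt w.length d (N + 2)) a b l k))
    (hP : P → ∀ o', o ≤ o' → o' < N → f d o' = false) :
    (palindromeMachine m).Decides w P (T + j + 1)
      (config .zeros d r i (squareAt w.length d (o + 1)) a b l k) := by
  have hlen := hw.length
  induction j generalizing o with
  | zero =>
    obtain rfl : o = N := ho
    exact decides_step (hT fun _ _ _ => by omega) (hw.dollar d) rfl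
      (away_apply_squareAt d (by omega))
  | succ j ih =>
    have hx := hw.digit d (o := o) (by omega)
    cases hβ : f d o with
    | true =>
      rw [hβ] at hx
      refine decides_reject (fun h => ?_) hx (by simp) rfl
      simp [hP h o le_rfl (by omega)] at hβ
    | false =>
      rw [hβ] at hx
      refine decides_step (ih (o := o + 1) (by omega) (fun h => hT fun o' h1 h2 => ?_)
        fun h o' h1 h2 => hP h o' (by omega) h2) hx rfl (away_apply_squareAt d (by omega))
      obtain rfl | h3 := h1.eq_or_lt
      · exact hβ
      · exact h o' h3 h2

theorem decides_cross (hw : MarkedTape w N f) {T o : ℕ} (ho : o ≤ N)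
    (hT : (palindromeMachine m).Decides w P T
      (config .skip (!d) r 0 (squareAt w.length (!d) 1) a b l k)) :
    (palindromeMachine m).Decides w P (T + o + 1)
      (config .cross d r i (squareAt w.length (!d) o) a b l k) := by
  have hlen := hw.length
  induction o with
  | zero =>
    have hc : controlStep m ⟨.cross, d, r, i⟩ (if !d then .rightEnd else .leftEnd) (a == 0)
        (b == 0) (l == 0) (k == 0) = some (⟨.skip, !d, r, 0⟩, .away !d, .keep, .keep, .keep,
        .keep) := by cases d <;> rfl
    exact decides_step hT (hw.marker !d) hc (away_apply_squareAt (!d) (by omega))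
  | succ o ih =>
    have hc : controlStep m ⟨.cross, d, r, i⟩ (.letter (Letter.ofBit (f (!d) o))) (a == 0)
        (b == 0) (l == 0) (k == 0) = some (⟨.cross, d, r, i⟩, .away d, .keep, .keep, .keep,
        .keep) := by cases f (!d) o <;> rfl
    refine decides_step (ih (by omega)) (hw.digit (!d) (by omega)) hc ?_
    simpa using away_not_apply_squareAt (n := w.length) (!d) (o := o) (by omega)

/-- Bits leave the stack in reverse order, so the comparison has to start at the innermost digit of
the prefix. The walk there also moves the distance from `K` back to `L`. -/
theorem decides_skip (hw : MarkedTape w N f) {T o j : ℕ} (ho : o + j ≤ N)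
    (hT : (palindromeMachine m).Decides w P T (config .decode d r (o + j : ℕ)
      (squareAt w.length d (o + j)) a b (o + j) 0)) :
    (palindromeMachine m).Decides w P (T + j + 1) (config .skip d r o
      (squareAt w.length d (o + 1)) a b o j) := by
  have hlen := hw.length
  induction j generalizing o with
  | zero => exact decides_step hT rfl rfl (away_not_apply_squareAt d (by omega))
  | succ j ih =>
    rw [show o + (j + 1) = o + 1 + j by omega] at hT
    exact decides_step (ih (o := o + 1) (by omega) hT) rfl (by push_cast; rfl)
      (away_apply_squareAt d (by omega))

/-- Here `g` holds the digits of the end that was encoded. A pop leaving v costs 3 * v + 4 steps,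
and 3 * v ≤ 2 * S since 2 * v is at most the value before the pop. -/
theorem decides_decode (hw : MarkedTape w N f) {T S o : ℕ} {g : ℕ → Bool} (ho : o ≤ N)
    (hS : ∀ o' ≤ o, classValue r g o' ≤ S)
    (hT : (∀ o' < o, (o' : ZMod (2 * m)) = r → g o' = f d o') →
      (palindromeMachine m).Decides w P T
        (config .restore d r 0 (squareAt w.length d 0) 0 0 0 (k + o)))
    (hP : P → ∀ o' < o, (o' : ZMod (2 * m)) = r → g o' = f d o') :
    (palindromeMachine m).Decides w P (T + o * (2 * S + 4) + 1) (config .decode d r o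
      (squareAt w.length d o) (classValue r g o) 0 o k) := by
  have hlen := hw.length
  induction o generalizing k with
  | zero =>
    rw [Nat.cast_zero]
    exact (decides_step (hT fun _ h => by omega) rfl rfl).mono (by omega)
  | succ o ih =>
    have hx := hw.digit d (o := o) (by omega)
    have hmv := away_not_apply_squareAt (n := w.length) d (o := o) (by omega)
    have hS0 := hS o (by omega)
    have hS1 := hS (o + 1) le_rfl
    have hi : ((o + 1 : ℕ) : ZMod (2 * m)) - 1 = o := by push_cast; ring
    have h0 (h : (o : ZMod (2 * m)) = r → g o = f d o) :
        (palindromeMachine m).Decides w P (T + o * (2 * S + 4) + 1) (config .decode d r o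
        (squareAt w.length d o) (classValue r g o) 0 o (k + 1)) := by
      refine ih (by omega) (fun o' h => hS o' (by omega)) (fun h' => ?_)
        fun h' o' h1 => hP h' o' (by omega)
      rw [show k + 1 + o = k + (o + 1) by omega]
      refine hT fun o' h1 h2 => ?_
      obtain h3 | rfl := Nat.lt_succ_iff_lt_or_eq.1 h1
      · exact h' o' h3 h2
      · exact h h2
    by_cases hr : (o : ZMod (2 * m)) = r
    · have h1 : (palindromeMachine m).Decides w P
          (T + o * (2 * S + 4) + 1 + (0 + classValue r g o) + 1 + 2 * classValue r g o + 2)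
          (config .half d r (o + 1 : ℕ)
          (squareAt w.length d (o + 1)) (2 * classValue r g o + (g o).toNat) 0 (o + 1) k) := by
        refine decides_half hx (fun h => ?_) fun h => hP h o (by omega) hr
        refine decides_halfBack (T := T + o * (2 * S + 4) + 1) ?_
        rw [hmv, hi, zero_add, zero_add]
        exact h0 fun _ => h
      rw [classValue, if_pos hr] at hS1 ⊢
      have hc : controlStep m ⟨.decode, d, r, (o + 1 : ℕ)⟩
          (tapeAt w (squareAt w.length d (o + 1))) (2 * classValue r g o + (g o).toNat == 0)
          (0 == 0) (o + 1 == 0) (k == 0) = some (⟨.half, d, r, (o + 1 : ℕ)⟩, .stay, .keep, .keep,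
          .keep, .keep) := if_pos (hi.trans hr)
      refine (decides_step h1 rfl hc).mono ?_
      have : (o + 1) * (2 * S + 4) = o * (2 * S + 4) + (2 * S + 4) := by ring
      omega
    · rw [classValue, if_neg hr]
      have hc : controlStep m ⟨.decode, d, r, (o + 1 : ℕ)⟩
          (tapeAt w (squareAt w.length d (o + 1))) (classValue r g o == 0) (0 == 0) (o + 1 == 0)
          (k == 0) = some (⟨.decode, d, r, o⟩, .away !d, .keep, .keep, .decrement,
          .increment) := by
        rw [← hi] at hr ⊢
        exact if_neg hr
      exact (decides_step (h0 fun h => absurd (hi ▸ h) hr) rfl hc hmv).mono (by nlinarith)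

end

/-! ### Passes over all residue classes. -/

section

variable {m : ℕ} [NeZero m] {d : Bool} {r : ZMod (2 * m)} {w : List Letter} {P : Prop} {N : ℕ}
  {f : Bool → ℕ → Bool}

/-- The walks over padding and far side, together with `skip`, take (N - K) + N + K = 2 * N moves.
The remaining factor 6 * S + 8 is (4 * S + 3) + (2 * S + 4) + 1, for encoding, decoding and
restoring `L`. -/
theorem decides_pass (hw : MarkedTape w N f) {T K S : ℕ}
    (hS : ∀ (f : ℕ → Bool), ∀ o ≤ K, classValue r f o ≤ S)
    (hT : K ≤ N → (∀ o, K ≤ o → o < N → f d o = false) →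
      (∀ o < K, (o : ZMod (2 * m)) = r → f d o = f (!d) o) →
      (palindromeMachine m).Decides w P T
        (config .restore (!d) r 0 (squareAt w.length (!d) 0) 0 0 K 0))
    (hP : P → K ≤ N ∧ (∀ o, K ≤ o → o < N → f d o = false) ∧
      ∀ o < K, f d o = f (!d) o) :
    (palindromeMachine m).Decides w P (T + w.length + K * (6 * S + 8) + 4)
      (config .encode d r 0 (squareAt w.length d 1) 0 0 K 0) := by
  have hlen := hw.length
  obtain hK | hK := lt_or_ge N K
  · have := decides_encode (T := 0) (r := r) (d := d) (S := S) (o := 0) (j := K) hw (by omega)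
      (fun o h => hS _ o (by omega)) (fun h => by omega) (fun h => by have := (hP h).1; omega)
    rw [Nat.cast_zero] at this
    exact this.mono (by nlinarith)
  have h1 (hz : ∀ o, K ≤ o → o < N → f d o = false) :
      (palindromeMachine m).Decides w P _ (config .decode (!d) r K
        (squareAt w.length (!d) K) (classValue r (f d) K) 0 K 0) :=
    decides_decode (T := T + K) (S := S) hw hK (fun o h => hS _ o h)
      (fun he => by
        rw [zero_add]
        exact decides_restore (by simpa using hT hK hz he))
      (fun h o ho _ => (hP h).2.2 o ho)
  have h2 (hz : ∀ o, K ≤ o → o < N → f d o = false) :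
      (palindromeMachine m).Decides w P (T + K + K * (2 * S + 4) + 1 + K + 1 + N + 1)
        (config .cross d r K (squareAt w.length d (N + 2)) (classValue r (f d) K) 0 0 K) := by
    have h3 := decides_cross (d := d) (i := K) hw le_rfl (T := T + K + K * (2 * S + 4) + 1 + K + 1)
      (by
        have := decides_skip (d := !d) (o := 0) (j := K) (a := classValue r (f d) K) (b := 0)
          (r := r) hw (by omega) (by simpa using h1 hz)
        rw [Nat.cast_zero] at this
        exact this)
    rw [squareAt_not d (by omega)] at h3
    rwa [show w.length + 1 - N = N + 2 by omega] at h3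
  have h4 := decides_encode (r := r) (d := d) (S := S) (o := 0) (j := K) hw (by omega)
      (fun o h => hS _ o (by omega))
      (fun h => by
        rw [zero_add]
        exact decides_zeros (j := N - K) hw (by omega) h2 fun h => (hP h).2.1)
      (fun h => by have := (hP h).1; omega)
  rw [Nat.cast_zero] at h4
  refine h4.mono ?_
  have : K * (6 * S + 8) = K * (4 * S + 3) + K * (2 * S + 4) + K := by ring
  omega

/-- Induction on the number j of passes after the current one. A pass checks the padding only on its
starting side, so the other side is known to be zero only if a further pass follows; initially this
holds as 2 * m ≥ 2. -/
theorem decides_passes (hw : MarkedTape w N f) {K S c j : ℕ} (hc : c + j + 1 = 2 * m)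
    (hS : ∀ (r : ZMod (2 * m)) (f : ℕ → Bool), ∀ o ≤ K, classValue r f o ≤ S)
    (hP : P → K ≤ N ∧ (∀ d o, K ≤ o → o < N → f d o = false) ∧ ∀ o < K, f false o = f true o)
    (hQ : K ≤ N → (∀ o, K ≤ o → o < N → f d o = false) →
      (1 ≤ j → ∀ o, K ≤ o → o < N → f (!d) o = false) →
      (∀ o < K, ∀ c', c ≤ c' → c' < 2 * m → (o : ZMod (2 * m)) = (c' : ZMod (2 * m)) →
        f d o = f (!d) o) → P) :
    (palindromeMachine m).Decides w P ((j + 1) * (w.length + K * (6 * S + 8) + 5))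
      (config .encode d c 0 (squareAt w.length d 1) 0 0 K 0) := by
  have hP' (d : Bool) (h : P) : K ≤ N ∧ (∀ o, K ≤ o → o < N → f d o = false) ∧
      ∀ o < K, f d o = f (!d) o := by
    obtain ⟨h1, h2, h3⟩ := hP h
    refine ⟨h1, h2 d, fun o ho => ?_⟩
    cases d
    · exact h3 o ho
    · exact (h3 o ho).symm
  have hlen := hw.length
  induction j generalizing c d with
  | zero =>
    refine (decides_pass (T := 1) hw (hS c) (fun h1 h2 h3 => ?_) (hP' d)).mono (by omega)
    have hr : (c : ZMod (2 * m)) = -1 := by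
      refine eq_neg_of_add_eq_zero_left ?_
      have h : ((c + 1 : ℕ) : ZMod (2 * m)) = 0 := by
        rw [show c + 1 = 2 * m by omega, ZMod.natCast_self]
      exact_mod_cast h
    refine decides_step (T := 0) (i' := 0) (decides_accept (hQ h1 h2 (by omega)
      fun o ho c' h4 h5 h6 => h3 o ho ?_)) rfl (if_pos hr)
    rw [h6, show c' = c by omega]
  | succ j ih =>
    have hr : (c : ZMod (2 * m)) ≠ -1 := fun h => by
      have h1 : ((c + 1 : ℕ) : ZMod (2 * m)) = 0 := by push_cast; rw [h]; ring
      have := Nat.le_of_dvd (by omega) ((ZMod.natCast_eq_zero_iff _ _).1 h1)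
      omega
    refine (decides_pass (T := (j + 1) * (w.length + K * (6 * S + 8) + 5) + 1) hw (hS c)
      (fun h1 h2 h3 => ?_) (hP' d)).mono (by
        rw [show (j + 1 + 1) * (w.length + K * (6 * S + 8) + 5) =
          (j + 1) * (w.length + K * (6 * S + 8) + 5) + (w.length + K * (6 * S + 8) + 5) by ring]
        omega)
    refine decides_step (ih (c := c + 1) (d := !d) (by omega) fun h4 h5 h6 h7 => ?_) rfl
      ((if_neg hr).trans (by push_cast; rfl)) (away_apply_squareAt (!d) (by omega))
    refine hQ h1 h2 (fun _ => h5) fun o ho c' h8 h9 h10 => ?_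
    obtain rfl | h11 := h8.eq_or_lt
    · exact h3 o ho h10
    · simpa using (h7 o ho c' h11 h9 h10).symm

end

/-! ### Words of the language as tapes. -/

theorem markedTape_append {u v : List Bool} (huv : v.length = u.length) :
    MarkedTape (u.map Letter.ofBit ++ .dollar :: v.map Letter.ofBit) u.length
      (fun d o => if d then v.reverse.getD o false else u.getD o false) where
  length := by simp [huv]; omega
  marker d := by
    cases d
    · simp [squareAt, tapeAt]
    · simp [squareAt, tapeAt]
  dollar d := by
    have : squareAt (u.map Letter.ofBit ++ .dollar :: v.map Letter.ofBit).length d (u.length + 1)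
        = u.length + 1 := by
      cases d <;> simp [squareAt, huv]
    rw [this]
    simp [tapeAt]
  digit d o ho := by
    cases d
    · simp [squareAt, tapeAt, List.getElem?_append_left, ho]
    · have : squareAt (u.map Letter.ofBit ++ .dollar :: v.map Letter.ofBit).length true (o + 1)
          = (u.length + (v.length - 1 - o) + 1) + 1 := by
        simp [squareAt, huv]; omega
      rw [this]
      have h1 : v.length - 1 - o < v.length := by omega
      have h2 : o < v.length := by omega
      simp [tapeAt, add_assoc, h1, h2]

theorem Letter.ofBit_injective : Function.Injective Letter.ofBit := by
  intro x y h
  cases x <;> cases y <;> first | rfl | cases h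

theorem map_ofBit_append_dollar_inj {u u' : List Bool} {t t' : List Letter} :
    u.map Letter.ofBit ++ .dollar :: t = u'.map Letter.ofBit ++ .dollar :: t' ↔
      u = u' ∧ t = t' := by
  constructor
  · intro h
    induction u generalizing u' with
    | nil =>
      cases u' with
      | nil => simpa using h
      | cons c u' => cases c <;> simp [Letter.ofBit] at h
    | cons b u ih =>
      cases u' with
      | nil => cases b <;> simp [Letter.ofBit] at h
      | cons c u' =>
        simp only [List.map_cons, List.cons_append, List.cons.injEq] at h
        obtain ⟨rfl, rfl⟩ := ih h.2
        simp [Letter.ofBit_injective h.1]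
  · rintro ⟨rfl, rfl⟩
    rfl

theorem markedPalindromes_eq_append {x : List Bool} {n : ℕ} :
    x.map Letter.ofBit ++ List.replicate n Letter.zero ++ [Letter.dollar]
        ++ List.replicate n Letter.zero ++ (x.map Letter.ofBit).reverse =
      (x ++ List.replicate n false).map Letter.ofBit ++
        .dollar :: ((x ++ List.replicate n false).reverse).map Letter.ofBit := by
  simp [Letter.ofBit]

/-- The word `x` is recovered as the first m * q digits of `u`. Beyond them both sides are zero, so
agreement on these digits already makes `v` the reversal of `u`. -/
theorem append_mem_markedPalindromes {m : ℕ} (hm : 0 < m) {u v : List Bool}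
    (huv : v.length = u.length) {f : Bool → ℕ → Bool}
    (hf : f = fun d o => if d then v.reverse.getD o false else u.getD o false) :
    u.map Letter.ofBit ++ .dollar :: v.map Letter.ofBit ∈ markedPalindromes m ↔
      ∃ q, u.length = 2 ^ q ∧ m * q ≤ u.length ∧
        (∀ d o, m * q ≤ o → o < u.length → f d o = false) ∧
        ∀ o < m * q, f false o = f true o := by
  subst hf
  constructor
  · rintro ⟨x, ⟨q, hq⟩, hx, h⟩
    rw [markedPalindromes_eq_append, map_ofBit_append_dollar_inj] at h
    obtain ⟨hu, hv⟩ := h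
    replace hv := Letter.ofBit_injective.list_map hv
    have hv' : v.reverse = u := by rw [hv, hu, List.reverse_reverse]
    rw [hq, Nat.mul_div_cancel_left _ hm] at hx hu
    have hl : u.length = 2 ^ q := by rw [hu]; simp [hq]; omega
    refine ⟨q, hl, by omega, fun d o h1 h2 => ?_, fun o _ => ?_⟩
    · have : u.getD o false = false := by
        rw [hu, List.getD_append_right _ _ _ _ (by omega)]
        rw [List.getD_eq_getElem?_getD, List.getElem?_replicate]
        split <;> rfl
      cases d <;> simpa [hv'] using this
    · simp [hv']
  · rintro ⟨q, hl, hle, hz, he⟩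
    have hv : v.reverse = u := by
      refine List.ext_getElem (by simp [huv]) fun o h1 h2 => ?_
      have h3 : (v.reverse).getD o false = u.getD o false := by
        obtain h | h := lt_or_ge o (m * q)
        · simpa using (he o h).symm
        · have h4 := hz true o h h2
          have h5 := hz false o h h2
          simp only [if_true] at h4
          simp only [Bool.false_eq_true, if_false] at h5
          rw [h4, h5]
      rwa [List.getD_eq_getElem _ _ h1, List.getD_eq_getElem _ _ h2] at h3
    have hxl : (u.take (m * q)).length = m * q := by simp [hle]
    refine ⟨u.take (m * q), ⟨q, hxl⟩, ?_, ?_⟩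
    · rw [hxl, Nat.mul_div_cancel_left _ hm]; omega
    · have hu : u.take (m * q) ++ List.replicate (2 ^ q - m * q) false = u := by
        conv_rhs => rw [← List.take_append_drop (m * q) u]
        congr 1
        refine (List.eq_replicate_iff.2 ⟨by simp [hl], fun b hb => ?_⟩).symm
        obtain ⟨i, hi, rfl⟩ := List.getElem_of_mem hb
        rw [List.length_drop] at hi
        have := hz false (m * q + i) (by omega) (by omega)
        simp only [Bool.false_eq_true, if_false] at this
        rw [List.getD_eq_getElem _ _ (by omega)] at this
        rwa [List.getElem_drop]
      rw [markedPalindromes_eq_append, hxl, Nat.mul_div_cancel_left _ hm, hu, ← hv,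
        List.reverse_reverse]

/-! ### The time bound and the conclusion. -/

/-- A bound for the number of steps the machine makes beyond the main term. -/
def lowerOrder (m n : ℕ) : ℕ :=
  -- With s = 2 ^ (log n / 2), the passes contribute 2 * m * (m * log n) * (12 * s + 8), hence 24 +
  -- 16 = 40; the other coefficients absorb the lower terms.
  (40 * m ^ 2 + 13 * m + 4) * ((Nat.log 2 n + 1) * 2 ^ (Nat.log 2 n / 2))

/-- The logarithm is o(√n) and the power of two is at most √n. -/
theorem lowerOrder_isLittleO (m : ℕ) :
    (fun n => (lowerOrder m n : ℝ)) =o[atTop] (fun n : ℕ => (n : ℝ)) := by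
  have hlog : (fun n : ℕ => ((Nat.log 2 n + 1 : ℕ) : ℝ)) =o[atTop]
      fun n : ℕ => (n : ℝ) ^ (1 / 2 : ℝ) := by
    have h1 : (fun x : ℝ => Real.log x / Real.log 2 + 1) =o[atTop] fun x : ℝ => x ^ (1 / 2 : ℝ) := by
      refine IsLittleO.add ?_ ?_
      · simp_rw [div_eq_inv_mul]
        exact (isLittleO_log_rpow_atTop (by norm_num)).const_mul_left _
      · refine (isLittleO_const_left.2 (Or.inr ?_))
        exact tendsto_norm_atTop_atTop.comp (tendsto_rpow_atTop (by norm_num))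
    refine IsBigO.trans_isLittleO ?_ (h1.comp_tendsto tendsto_natCast_atTop_atTop)
    refine IsBigO.of_bound 1 ?_
    filter_upwards [eventually_ge_atTop 1] with n hn
    have h2 := Real.natLog_le_logb n 2
    rw [one_mul, Real.norm_of_nonneg (by positivity)]
    refine le_trans ?_ (le_abs_self _)
    simp only [Function.comp]
    push_cast at h2 ⊢
    rw [Real.logb] at h2
    linarith
  have hpow : (fun n : ℕ => ((2 ^ (Nat.log 2 n / 2) : ℕ) : ℝ)) =O[atTop]
      fun n : ℕ => (n : ℝ) ^ (1 / 2 : ℝ) := by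
    refine IsBigO.of_bound 1 ?_
    filter_upwards [eventually_ge_atTop 1] with n hn
    rw [one_mul, Real.norm_of_nonneg (by positivity), Real.norm_of_nonneg (by positivity),
      ← Real.sqrt_eq_rpow]
    refine Real.le_sqrt_of_sq_le ?_
    have h1 : (2 ^ (Nat.log 2 n / 2)) ^ 2 ≤ n := by
      rw [← pow_mul]
      exact (Nat.pow_le_pow_right (by omega) (Nat.div_mul_le_self _ _)).trans
        (Nat.pow_log_le_self 2 (by omega))
    exact_mod_cast h1
  have h := (hlog.mul_isBigO hpow).const_mul_left ((40 * m ^ 2 + 13 * m + 4 : ℕ) : ℝ)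
  refine (h.congr_left fun n => ?_).congr' EventuallyEq.rfl ?_
  · simp only [lowerOrder]
    push_cast
    ring
  · filter_upwards with n
    rw [← Real.sqrt_eq_rpow, Real.mul_self_sqrt (by positivity)]

theorem palindromeMachine_decides (m : ℕ) [NeZero m] (w : List Letter) :
    (palindromeMachine m).Decides w (w ∈ markedPalindromes m)
      ((2 * m + 3) * w.length + lowerOrder m w.length) (palindromeMachine m).init := by
  have hm : 0 < m := NeZero.pos m
  have hinit : (palindromeMachine m).init = config .scanLeft true 0 0 1 0 0 0 0 := by
    simp only [CounterMachine.init, config, palindromeMachine, CounterMachine.Config.mk.injEq,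
      true_and]
    funext j
    fin_cases j <;> rfl
  rw [hinit]
  set q₀ := Nat.log 2 w.length with hq₀
  set s := 2 ^ (q₀ / 2) with hs
  have hs1 : 1 ≤ s := Nat.one_le_two_pow
  have h := decides_scanLeft (m := m) (P := w ∈ markedPalindromes m) (d := true) (r := 0) (i := 0)
    (a := 0) (w := w)
    -- The 2 * m passes, with m * q₀ bounding the prefix length and 2 * s the stack, followed by the
    -- halving cost, where 3 * N ≤ 2 * n.
    (T := 2 * m * (w.length + m * q₀ * (6 * (2 * s) + 8) + 5) + 2 * w.length + (m + 3) * (q₀ + 1))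
    [] w rfl ?_ ?_
  · refine h.mono ?_
    have : lowerOrder m w.length = (40 * m ^ 2 + 13 * m + 4) * ((q₀ + 1) * s) := rfl
    rw [this]
    have h1 : q₀ + 1 ≤ (q₀ + 1) * s := Nat.le_mul_of_pos_right _ hs1
    have h2 : q₀ * s + s = (q₀ + 1) * s := by ring
    have h3 := Nat.mul_le_mul_left (m ^ 2) h1
    have h4 := Nat.mul_le_mul_left m h1
    have h5 : 0 ≤ m ^ 2 * s := Nat.zero_le _
    nlinarith
  · intro u v hw huv
    rw [zero_add] at huv
    have hmem := append_mem_markedPalindromes hm huv rfl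
    have htape := markedTape_append huv
    rw [← hw] at hmem htape
    have hlen := htape.length
    have hlog : Nat.log 2 v.length ≤ q₀ := Nat.log_mono_right (by omega)
    refine (decides_halve (T := 2 * m * (w.length + m * q₀ * (6 * (2 * s) + 8) + 5))
      (fun q hq => ?_) fun h => ?_).mono ?_
    · have hqq : q ≤ q₀ := by
        rw [hq, Nat.log_pow (by omega)] at hlog
        exact hlog
      have h0 : w.length + 1 = squareAt w.length true 0 := rfl
      rw [h0, away_apply_squareAt true (by omega), zero_add, zero_add]
      have hp := decides_passes (m := m) (P := w ∈ markedPalindromes m) (d := true) (c := 0)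
        (j := 2 * m - 1) (K := m * q) (S := 2 * s) htape (by omega) ?_ ?_ ?_
      · rw [Nat.cast_zero] at hp
        refine hp.mono ?_
        rw [show 2 * m - 1 + 1 = 2 * m by omega]
        gcongr
      · intro r g o ho
        have : NeZero (2 * m) := ⟨by omega⟩
        refine (classValue_lt r g o).le.trans ?_
        rw [pow_succ, mul_comm]
        -- Here o ≤ m * q ≤ m * q₀; the modulus 2 * m is what halves the exponent.
        have : o / (2 * m) ≤ q₀ / 2 := by
          rw [← Nat.div_div_eq_div_mul]
          calc o / 2 / m ≤ m * q₀ / 2 / m := by gcongr; exact ho.trans (by gcongr)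
            _ = m * q₀ / m / 2 := Nat.div_right_comm _ _ _
            _ = q₀ / 2 := by rw [Nat.mul_div_cancel_left _ hm]
        have h2 : 2 ^ (o / (2 * m)) ≤ s := Nat.pow_le_pow_right (by omega) this
        omega
      · intro h
        obtain ⟨q', h1, h2, h3, h4⟩ := hmem.1 h
        obtain rfl : q' = q := Nat.pow_right_injective le_rfl (by simp only; omega)
        exact ⟨h2, h3, h4⟩
      · intro h1 h2 h3 h4
        refine hmem.2 ⟨q, by omega, h1, fun d => ?_, fun o ho => ?_⟩
        · cases d
          · exact h3 (by omega)
          · exact h2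
        -- Every position is compared in the pass for its own residue class.
        · refine (h4 o ho (o % (2 * m)) (Nat.zero_le _) (Nat.mod_lt _ (by omega)) ?_).symm
          rw [ZMod.natCast_mod]
    · obtain ⟨q, h1, -⟩ := hmem.1 h
      exact ⟨q, by omega⟩
    · have : (m + 3) * (Nat.log 2 v.length + 1) ≤ (m + 3) * (q₀ + 1) := by gcongr
      omega
  · rintro ⟨x, -, -, h⟩
    rw [markedPalindromes_eq_append] at h
    exact ⟨_, _, h, by simp [add_comm]⟩

theorem mainTheorem7 (m : ℕ) (hm : 1 ≤ m) :
    ∃ (M : CounterMachine 4 Letter) (f : ℕ → ℝ),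
      f =o[atTop] (fun n : ℕ => (n : ℝ)) ∧
      M.acceptedLanguage = markedPalindromes m ∧
      ∀ w : List Letter, ∃ t : ℕ,
        (t : ℝ) ≤ (2 * (m : ℝ) + 3) * (w.length : ℝ) + f w.length ∧ M.HaltsWithin w t := by
  have : NeZero m := ⟨by omega⟩
  refine ⟨palindromeMachine m, fun n => lowerOrder m n, lowerOrder_isLittleO m, ?_, fun w => ?_⟩
  · ext w
    exact (palindromeMachine_decides m w).accepts_iff
  · obtain ⟨t, ht, h⟩ := (palindromeMachine_decides m w).exists_haltsWithin
    exact ⟨t, by beta_reduce; exact_mod_cast ht, h⟩
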